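/- Let $\mathcal H^2$ be the hyperbolic plane of curvature $-1$, and give $\mathcal H^2\times\mathbb R$ the product metric $d\zeta^2+dt^2$, where $d\zeta^2$ is the metric of $\mathcal H^2$. Let $I\subset\mathbb R$ be an open interval and let $\gamma:I\to\mathcal H^2$ be a smooth regular curve, that is, $\gamma'(u)\neq0$ for all $u\in I$. Let $M=\gamma\times\mathbb R$ be the cylinder over $\gamma$, that is, the surface immersed in $\mathcal H^2\times\mathbb R$ by $(u,t)\mapsto(\gamma(u),t)$, $(u,t)\in I\times\mathbb R$. Then: 1. the metric induced on $M$ is $ds^2+dt^2$, where $s$ is the arc length of $\gamma$; 2. the Gaussian (intrinsic) curvature of $M$, i.e. the curvature of the induced metric, is identically zero; 3. at every point of $M$ one of the two principal curvatures (the eigenvalues of the shape operator, for either choice of unit normal) is zero; hence the extrinsic curvature of $M$, which is the product of the principal curvatures, is identically zero. -/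

import Mathlib

open scoped ContDiff

noncomputable section

namespace CylinderTheorem

/-! ## Riemannian geometry in coordinates

A point of coordinate space is a function `x : ι → ℝ`; a Riemannian metric is given by its matrix
`G x` of coefficients in these coordinates. -/

section Coordinates

variable {ι κ : Type*} [Fintype ι] [DecidableEq ι] [Fintype κ] [DecidableEq κ]

/-- The partial derivative `∂f/∂xᵃ` at `x`. -/
def partialD {F : Type*} [NormedAddCommGroup F] [NormedSpace ℝ F]
    (a : ι) (f : (ι → ℝ) → F) (x : ι → ℝ) : F :=
  fderiv ℝ f x (Pi.single a 1)

/-- The bilinear form `g(v, w) = ∑ gᵢⱼ vⁱ wʲ` of a matrix of coefficients. -/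
def innerG (g : Matrix ι ι ℝ) (v w : ι → ℝ) : ℝ := ∑ i, ∑ j, g i j * v i * w j

/-- The Christoffel symbols `Γᵏᵢⱼ` of the Levi-Civita connection of the metric `G`:
`Γᵏᵢⱼ = ½ ∑ₗ gᵏˡ (∂ᵢ gⱼₗ + ∂ⱼ gᵢₗ - ∂ₗ gᵢⱼ)`. -/
def christoffel (G : (ι → ℝ) → Matrix ι ι ℝ) (k i j : ι) (x : ι → ℝ) : ℝ :=
  (1 / 2 : ℝ) * ∑ l, (G x)⁻¹ k l *
    (partialD i (fun z => G z j l) x + partialD j (fun z => G z i l) x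
      - partialD l (fun z => G z i j) x)

/-- The coefficients of the curvature tensor, `R(∂ᵢ, ∂ⱼ)∂ₖ = ∑ₗ (riemann G l k i j) ∂ₗ`, where
`R(U, V)W = ∇_U ∇_V W - ∇_V ∇_U W - ∇_{[U, V]} W`. -/
def riemann (G : (ι → ℝ) → Matrix ι ι ℝ) (l k i j : ι) (x : ι → ℝ) : ℝ :=
  partialD i (christoffel G l j k) x - partialD j (christoffel G l i k) x
    + ∑ m, (christoffel G l i m x * christoffel G m j k x
      - christoffel G l j m x * christoffel G m i k x)

/-- The Gaussian (intrinsic) curvature of a two-dimensional Riemannian metric: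
`K = g(R(∂₀, ∂₁)∂₁, ∂₀) / det g`. -/
def gaussianCurvature (G : (Fin 2 → ℝ) → Matrix (Fin 2) (Fin 2) ℝ) (x : Fin 2 → ℝ) : ℝ :=
  (∑ l, G x l 0 * riemann G l 1 0 1 x) / (G x).det

/-- The metric induced by `X` from the metric `G` (first fundamental form):
`(X^* g)ₐᵦ = g(∂ₐX, ∂ᵦX)`. -/
def inducedMetric (G : (κ → ℝ) → Matrix κ κ ℝ) (X : (ι → ℝ) → (κ → ℝ)) (p : ι → ℝ) :
    Matrix ι ι ℝ :=
  Matrix.of fun a b => innerG (G (X p)) (partialD a X p) (partialD b X p)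

/-- The covariant derivative along `X`, in the direction of the parameter `a`, of the vector field
`V` along `X`, for the Levi-Civita connection of `G`:
`(D̄ₐV)ᵏ = ∂ₐVᵏ + ∑ Γᵏᵢⱼ(X) ∂ₐXⁱ Vʲ`. -/
def covDerivAlong (G : (κ → ℝ) → Matrix κ κ ℝ) (X : (ι → ℝ) → (κ → ℝ)) (a : ι)
    (V : (ι → ℝ) → (κ → ℝ)) (p : ι → ℝ) : κ → ℝ :=
  fun k => partialD a V p k
    + ∑ i, ∑ j, christoffel G k i j (X p) * partialD a X p i * V p j

/-- `X` is a smooth immersion on the set `U`. -/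
def IsImmersionOn (X : (ι → ℝ) → (κ → ℝ)) (U : Set (ι → ℝ)) : Prop :=
  ContDiffOn ℝ ∞ X U ∧ ∀ p ∈ U, LinearIndependent ℝ (fun a => partialD a X p)

/-- `n` is a unit normal vector of `X` at the parameter `p`. -/
def IsUnitNormal (G : (κ → ℝ) → Matrix κ κ ℝ) (X : (ι → ℝ) → (κ → ℝ)) (p : ι → ℝ)
    (n : κ → ℝ) : Prop :=
  innerG (G (X p)) n n = 1 ∧ ∀ a, innerG (G (X p)) n (partialD a X p) = 0

/-- The second fundamental form of `X` at `p` with respect to the unit normal vector `n`: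
`IIₐᵦ = g(D̄ₐ ∂ᵦX, n)`. -/
def secondFundamentalForm (G : (κ → ℝ) → Matrix κ κ ℝ) (X : (ι → ℝ) → (κ → ℝ)) (p : ι → ℝ)
    (n : κ → ℝ) : Matrix ι ι ℝ :=
  Matrix.of fun a b => innerG (G (X p)) (covDerivAlong G X a (partialD b X) p) n

/-- The matrix, in the basis `∂ₐX` of the tangent space, of the shape operator `S`, which is
determined by `g(S(∂ₐX), ∂ᵦX) = IIₐᵦ`. -/
def shapeOperator (G : (κ → ℝ) → Matrix κ κ ℝ) (X : (ι → ℝ) → (κ → ℝ)) (p : ι → ℝ)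
    (n : κ → ℝ) : Matrix ι ι ℝ :=
  (inducedMetric G X p)⁻¹ * secondFundamentalForm G X p n

/-- The principal curvatures: the eigenvalues of the shape operator, with multiplicity. -/
def principalCurvatures (G : (κ → ℝ) → Matrix κ κ ℝ) (X : (ι → ℝ) → (κ → ℝ)) (p : ι → ℝ)
    (n : κ → ℝ) : Multiset ℝ :=
  (shapeOperator G X p n).charpoly.roots

/-- The extrinsic curvature: the product of the principal curvatures. -/
def extrinsicCurvature (G : (κ → ℝ) → Matrix κ κ ℝ) (X : (ι → ℝ) → (κ → ℝ)) (p : ι → ℝ)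
    (n : κ → ℝ) : ℝ :=
  (principalCurvatures G X p n).prod

end Coordinates

/-! ## The hyperbolic plane and its product with the line -/

/-- The coordinates `(x, y)` of the point `x + iy` of the upper half-plane. -/
def hypCoord (z : UpperHalfPlane) : Fin 2 → ℝ := ![z.re, z.im]

/-- The metric `(dx² + dy²) / y²` of the hyperbolic plane (upper half-plane model, curvature
`-1`). -/
def hypMetric (x : Fin 2 → ℝ) : Matrix (Fin 2) (Fin 2) ℝ :=
  Matrix.diagonal ![1 / x 1 ^ 2, 1 / x 1 ^ 2]

/-- The coordinates `(x, y, t)` of the point `(x + iy, t)` of `H² × ℝ`. -/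
def prodCoord (q : UpperHalfPlane × ℝ) : Fin 3 → ℝ := ![q.1.re, q.1.im, q.2]

/-- The product metric `(dx² + dy²) / y² + dt²` of `H² × ℝ`. -/
def prodMetric (x : Fin 3 → ℝ) : Matrix (Fin 3) (Fin 3) ℝ :=
  Matrix.diagonal ![1 / x 1 ^ 2, 1 / x 1 ^ 2, 1]

/-! ## Curves in the hyperbolic plane and cylinders -/

/-- `γ` is a regular curve on `I`: it is smooth and its velocity does not vanish. -/
def IsRegularCurve (γ : ℝ → UpperHalfPlane) (I : Set ℝ) : Prop :=
  ContDiffOn ℝ ∞ (fun u => hypCoord (γ u)) I ∧ ∀ u ∈ I, deriv (fun v => hypCoord (γ v)) u ≠ 0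

/-- The hyperbolic length of the velocity of `γ`. -/
def hypSpeed (γ : ℝ → UpperHalfPlane) (u : ℝ) : ℝ :=
  Real.sqrt (innerG (hypMetric (hypCoord (γ u)))
    (deriv (fun v => hypCoord (γ v)) u) (deriv (fun v => hypCoord (γ v)) u))

/-- The (signed) hyperbolic arc length of `γ`, measured from the parameter `u₀`. -/
def arcLength (γ : ℝ → UpperHalfPlane) (u₀ u : ℝ) : ℝ := ∫ v in u₀..u, hypSpeed γ v

/-- The cylinder `γ × ℝ` in `H² × ℝ` over the curve `γ` with parameter set `I`. -/
def cylinder (γ : ℝ → UpperHalfPlane) (I : Set ℝ) : Set (UpperHalfPlane × ℝ) :=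
  (γ '' I) ×ˢ Set.univ

/-- The parameter domain `I × ℝ` of the cylinder. -/
def strip (I : Set ℝ) : Set (Fin 2 → ℝ) := {p | p 0 ∈ I}

/-- The map `(u, t) ↦ (γ(u), t)`. -/
def cylinderMap (γ : ℝ → UpperHalfPlane) (p : Fin 2 → ℝ) : UpperHalfPlane × ℝ := (γ (p 0), p 1)

/-- The map `(u, t) ↦ (γ(u), t)` in the coordinates of `H² × ℝ`. -/
def cylinderParam (γ : ℝ → UpperHalfPlane) (p : Fin 2 → ℝ) : Fin 3 → ℝ :=
  prodCoord (cylinderMap γ p)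

/-- The Euclidean metric of the plane, with coordinates `(s, t)`: `ds² + dt²`. -/
def euclMetric (_ : Fin 2 → ℝ) : Matrix (Fin 2) (Fin 2) ℝ := 1

/-- The map `(u, t) ↦ (s(u), t)`, where `s` is the arc length of `γ`. -/
def arcLengthCoord (γ : ℝ → UpperHalfPlane) (u₀ : ℝ) (p : Fin 2 → ℝ) : Fin 2 → ℝ :=
  ![arcLength γ u₀ (p 0), p 1]

end CylinderTheorem

end

namespace CylinderTheorem

/-! The vertical field `∂_t` is parallel in the product: the coefficients of `prodMetric` do not
depend on `t` and its last row and column are constant, so every Christoffel symbol with a lower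
index `2` vanishes (`prodMetric_christoffel`). This field is tangent to the cylinder, so its row and
column of the second fundamental form vanish (`covDerivAlong_eq_zero`), and the shape operator is
`diag(κ, 0)`. Intrinsically, the induced metric is `diag(hypSpeed², 1)`, which is also the pullback
of `ds² + dt²` because the derivative of arc length is the speed. The same remark on constant rows,
`christoffel_eq_zero_of_row`, then gives flatness. -/

/-- A function that is constant along a coordinate line has vanishing partial derivative. -/
theorem partialD_eq_zero_of_invariant {ι F : Type*} [Fintype ι] [DecidableEq ι]
    [NormedAddCommGroup F] [NormedSpace ℝ F] {f : (ι → ℝ) → F} {a : ι} {x : ι → ℝ}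
    (h : ∀ t : ℝ, f (x + t • Pi.single a 1) = f x) : partialD a f x = 0 := by
  unfold partialD
  by_cases hf : DifferentiableAt ℝ f x
  · rw [← hf.lineDeriv_eq_fderiv, lineDeriv]
    simp only [h, deriv_const]
  -- Here `fderiv` takes its default value `0`, so no regularity of `f` is required.
  · simp [fderiv_zero_of_not_differentiableAt hf]

theorem partialD_const {ι F : Type*} [Fintype ι] [DecidableEq ι]
    [NormedAddCommGroup F] [NormedSpace ℝ F] (c : F) (a : ι) (x : ι → ℝ) :
    partialD a (fun _ => c) x = 0 :=
  partialD_eq_zero_of_invariant fun _ => rfl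

theorem partialD_congr {ι F : Type*} [Fintype ι] [DecidableEq ι]
    [NormedAddCommGroup F] [NormedSpace ℝ F] {f g : (ι → ℝ) → F} {U : Set (ι → ℝ)}
    (hU : IsOpen U) (h : Set.EqOn f g U) (a : ι) {x : ι → ℝ} (hx : x ∈ U) :
    partialD a f x = partialD a g x := by
  unfold partialD
  rw [(h.eventuallyEq_of_mem (hU.mem_nhds hx)).fderiv_eq]

/-- If one row of coefficients of the metric is constant and the metric is invariant in the
corresponding coordinate, the Christoffel symbols with that lower index vanish. -/
theorem christoffel_eq_zero_of_row {ι : Type*} [Fintype ι] [DecidableEq ι]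
    {G : (ι → ℝ) → Matrix ι ι ℝ} {a : ι} {x : ι → ℝ}
    (hrow : ∀ i l, partialD i (fun z => G z a l) x = 0)
    (hcol : ∀ i l, partialD i (fun z => G z l a) x = 0)
    (hinv : ∀ i j, partialD a (fun z => G z i j) x = 0) (k j : ι) :
    christoffel G k a j x = 0 ∧ christoffel G k j a x = 0 := by
  simp [christoffel, hrow, hcol, hinv]

theorem prodMetric_christoffel (x : Fin 3 → ℝ) (k j : Fin 3) :
    christoffel prodMetric k 2 j x = 0 ∧ christoffel prodMetric k j 2 x = 0 := by
  refine christoffel_eq_zero_of_row (fun i l => ?_) (fun i l => ?_) (fun i j => ?_) k j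
  · refine (congrArg (fun f => partialD i f x) (funext fun z => ?_)).trans
      (partialD_const ((1 : Matrix (Fin 3) (Fin 3) ℝ) 2 l) i x)
    fin_cases l <;> simp [prodMetric, Matrix.one_apply]
  · refine (congrArg (fun f => partialD i f x) (funext fun z => ?_)).trans
      (partialD_const ((1 : Matrix (Fin 3) (Fin 3) ℝ) l 2) i x)
    fin_cases l <;> simp [prodMetric, Matrix.one_apply]
  · exact partialD_eq_zero_of_invariant fun t => by simp [prodMetric]

theorem innerG_prodMetric (x v w : Fin 3 → ℝ) :
    innerG (prodMetric x) v w =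
      (v 0 * w 0 + v 1 * w 1) / x 1 ^ 2 + v 2 * w 2 := by
  simp [innerG, prodMetric, Fin.sum_univ_three, Matrix.diagonal_apply]
  ring

theorem innerG_hypMetric (x v w : Fin 2 → ℝ) :
    innerG (hypMetric x) v w = (v 0 * w 0 + v 1 * w 1) / x 1 ^ 2 := by
  simp [innerG, hypMetric, Fin.sum_univ_two, Matrix.diagonal_apply]
  ring

theorem innerG_one (v w : Fin 2 → ℝ) :
    innerG (1 : Matrix (Fin 2) (Fin 2) ℝ) v w = v 0 * w 0 + v 1 * w 1 := by
  simp [innerG, Fin.sum_univ_two]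

theorem isOpen_strip {I : Set ℝ} (hI : IsOpen I) : IsOpen (strip I) :=
  hI.preimage (continuous_apply 0)

/-! ### Speed and arc length of a regular curve -/

section RegularCurve

variable {I : Set ℝ} {γ : ℝ → UpperHalfPlane}

theorem IsRegularCurve.hasDerivAt (hI : IsOpen I) (hγ : IsRegularCurve γ I) {u : ℝ} (hu : u ∈ I) :
    HasDerivAt (fun v => hypCoord (γ v)) (deriv (fun v => hypCoord (γ v)) u) u :=
  ((hγ.1.contDiffAt (hI.mem_nhds hu)).differentiableAt (by simp)).hasDerivAt

theorem IsRegularCurve.hypSpeed_radicand_pos (hγ : IsRegularCurve γ I) {u : ℝ} (hu : u ∈ I) :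
    0 < innerG (hypMetric (hypCoord (γ u)))
      (deriv (fun v => hypCoord (γ v)) u) (deriv (fun v => hypCoord (γ v)) u) := by
  rw [innerG_hypMetric]
  have him : 0 < hypCoord (γ u) 1 := (γ u).im_pos
  refine div_pos ?_ (by positivity)
  -- A sum of two squares that is not positive forces both velocity components to vanish, against
  -- regularity.
  by_contra! h
  refine hγ.2 u hu (funext fun i => ?_)
  fin_cases i
  · simp only [Fin.zero_eta, Pi.zero_apply]; nlinarith
  · simp only [Fin.mk_one, Pi.zero_apply]; nlinarith

theorem IsRegularCurve.hypSpeed_pos (hγ : IsRegularCurve γ I) {u : ℝ} (hu : u ∈ I) :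
    0 < hypSpeed γ u :=
  Real.sqrt_pos.2 (hγ.hypSpeed_radicand_pos hu)

theorem IsRegularCurve.hypSpeed_sq (hγ : IsRegularCurve γ I) {u : ℝ} (hu : u ∈ I) :
    hypSpeed γ u ^ 2 =
      (deriv (fun v => hypCoord (γ v)) u 0 ^ 2 + deriv (fun v => hypCoord (γ v)) u 1 ^ 2) /
        (γ u).im ^ 2 := by
  rw [hypSpeed, Real.sq_sqrt (hγ.hypSpeed_radicand_pos hu).le, innerG_hypMetric]
  simp [hypCoord, sq]

theorem IsRegularCurve.contDiffOn_hypSpeed (hI : IsOpen I) (hγ : IsRegularCurve γ I) :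
    ContDiffOn ℝ ∞ (hypSpeed γ) I := by
  refine ContDiffOn.sqrt ?_ fun u hu => (hγ.hypSpeed_radicand_pos hu).ne'
  simp only [innerG_hypMetric]
  have hc := contDiffOn_pi.1 hγ.1
  have hd := contDiffOn_pi.1 ((contDiffOn_infty_iff_deriv_of_isOpen hI).1 hγ.1).2
  exact ((((hd 0).mul (hd 0)).add ((hd 1).mul (hd 1))).div ((hc 1).pow 2)
    fun u _ => pow_ne_zero 2 (γ u).im_pos.ne')

/-- Fundamental theorem of calculus: order-connectedness keeps the segment from `u₀` to `u` inside
`I`, where the speed is continuous. -/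
theorem IsRegularCurve.hasDerivAt_arcLength (hI : IsOpen I) (hI' : I.OrdConnected)
    (hγ : IsRegularCurve γ I) {u₀ u : ℝ} (hu₀ : u₀ ∈ I) (hu : u ∈ I) :
    HasDerivAt (arcLength γ u₀) (hypSpeed γ u) u := by
  have hc := (hγ.contDiffOn_hypSpeed hI).continuousOn
  exact intervalIntegral.integral_hasDerivAt_right
    (hc.mono (hI'.uIcc_subset hu₀ hu)).intervalIntegrable
    (hc.stronglyMeasurableAtFilter hI u hu) (hc.continuousAt (hI.mem_nhds hu))

theorem IsRegularCurve.contDiffOn_arcLength (hI : IsOpen I) (hI' : I.OrdConnected)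
    (hγ : IsRegularCurve γ I) {u₀ : ℝ} (hu₀ : u₀ ∈ I) :
    ContDiffOn ℝ ∞ (arcLength γ u₀) I :=
  (contDiffOn_infty_iff_deriv_of_isOpen hI).2
    ⟨fun _ hu => (hγ.hasDerivAt_arcLength hI hI' hu₀ hu).differentiableAt.differentiableWithinAt,
      (hγ.contDiffOn_hypSpeed hI).congr fun _ hu =>
        (hγ.hasDerivAt_arcLength hI hI' hu₀ hu).deriv⟩

theorem IsRegularCurve.strictMonoOn_arcLength (hI : IsOpen I) (hI' : I.OrdConnected)
    (hγ : IsRegularCurve γ I) {u₀ : ℝ} (hu₀ : u₀ ∈ I) :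
    StrictMonoOn (arcLength γ u₀) I := by
  refine strictMonoOn_of_deriv_pos hI'.convex
    (hγ.contDiffOn_arcLength hI hI' hu₀).continuousOn fun u hu => ?_
  have hu := interior_subset hu
  rw [(hγ.hasDerivAt_arcLength hI hI' hu₀ hu).deriv]
  exact hγ.hypSpeed_pos hu

/-! ### The coordinate vector fields of the cylinder -/

theorem hasFDerivAt_coord {n : ℕ} (i : Fin n) (p : Fin n → ℝ) :
    HasFDerivAt (fun q : Fin n → ℝ => q i)
      (ContinuousLinearMap.proj (R := ℝ) (φ := fun _ : Fin n => ℝ) i) p :=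
  (ContinuousLinearMap.proj (R := ℝ) (φ := fun _ : Fin n => ℝ) i).hasFDerivAt

theorem IsRegularCurve.partialD_cylinderParam (hI : IsOpen I) (hγ : IsRegularCurve γ I)
    {p : Fin 2 → ℝ} (hp : p ∈ strip I) (a : Fin 2) :
    partialD a (cylinderParam γ) p =
      ![![deriv (fun v => hypCoord (γ v)) (p 0) 0, deriv (fun v => hypCoord (γ v)) (p 0) 1, 0],
        ![0, 0, 1]] a := by
  have hd := hasDerivAt_pi.1 (hγ.hasDerivAt hI hp)
  have h : ∀ i, HasFDerivAt (fun q => cylinderParam γ q i) (![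
      deriv (fun v => hypCoord (γ v)) (p 0) 0 •
        ContinuousLinearMap.proj (R := ℝ) (φ := fun _ : Fin 2 => ℝ) 0,
      deriv (fun v => hypCoord (γ v)) (p 0) 1 •
        ContinuousLinearMap.proj (R := ℝ) (φ := fun _ : Fin 2 => ℝ) 0,
      ContinuousLinearMap.proj (R := ℝ) (φ := fun _ : Fin 2 => ℝ) 1] i) p := by
    intro i
    fin_cases i
    · exact (hd 0).comp_hasFDerivAt p (hasFDerivAt_coord 0 p)
    · exact (hd 1).comp_hasFDerivAt p (hasFDerivAt_coord 0 p)
    · exact hasFDerivAt_coord 1 p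
  rw [partialD, (hasFDerivAt_pi.2 h).fderiv]
  ext i
  fin_cases a <;> fin_cases i <;> simp

theorem IsRegularCurve.partialD_arcLengthCoord (hI : IsOpen I) (hI' : I.OrdConnected)
    (hγ : IsRegularCurve γ I) {u₀ : ℝ} (hu₀ : u₀ ∈ I) {p : Fin 2 → ℝ} (hp : p ∈ strip I)
    (a : Fin 2) :
    partialD a (arcLengthCoord γ u₀) p = ![![hypSpeed γ (p 0), 0], ![0, 1]] a := by
  have h : ∀ i, HasFDerivAt (fun q => arcLengthCoord γ u₀ q i) (![
      hypSpeed γ (p 0) • ContinuousLinearMap.proj (R := ℝ) (φ := fun _ : Fin 2 => ℝ) 0,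
      ContinuousLinearMap.proj (R := ℝ) (φ := fun _ : Fin 2 => ℝ) 1] i) p := by
    intro i
    fin_cases i
    · exact (hγ.hasDerivAt_arcLength hI hI' hu₀ hp).comp_hasFDerivAt p (hasFDerivAt_coord 0 p)
    · exact hasFDerivAt_coord 1 p
  rw [partialD, (hasFDerivAt_pi.2 h).fderiv]
  ext i
  fin_cases a <;> fin_cases i <;> simp

theorem IsRegularCurve.isImmersionOn_cylinderParam (hI : IsOpen I) (hγ : IsRegularCurve γ I) :
    IsImmersionOn (cylinderParam γ) (strip I) := by
  refine ⟨contDiffOn_pi.2 fun i => ?_, fun p hp => ?_⟩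
  · have hc := contDiffOn_pi.1 hγ.1
    have h0 : ContDiffOn ℝ ∞ (fun q : Fin 2 → ℝ => q 0) (strip I) :=
      (contDiff_apply ℝ ℝ 0).contDiffOn
    fin_cases i
    · exact (hc 0).comp h0 fun _ h => h
    · exact (hc 1).comp h0 fun _ h => h
    · exact (contDiff_apply ℝ ℝ 1).contDiffOn
  · simp only [hγ.partialD_cylinderParam hI hp]
    refine LinearIndependent.pair_iff.2 fun s t hst => ?_
    have e (i : Fin 3) := congrFun hst i
    have e0 := e 0
    have e1 := e 1
    have e2 := e 2
    simp at e0 e1 e2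
    refine ⟨?_, e2⟩
    by_contra hs
    refine hγ.2 _ hp (funext fun i => ?_)
    fin_cases i
    · exact e0.resolve_left hs
    · exact e1.resolve_left hs

theorem IsRegularCurve.inducedMetric_cylinderParam (hI : IsOpen I) (hγ : IsRegularCurve γ I)
    {p : Fin 2 → ℝ} (hp : p ∈ strip I) :
    inducedMetric prodMetric (cylinderParam γ) p =
      Matrix.diagonal ![hypSpeed γ (p 0) ^ 2, 1] := by
  have hs := hγ.hypSpeed_sq hp
  ext a b
  simp only [inducedMetric, Matrix.of_apply, innerG_prodMetric, hγ.partialD_cylinderParam hI hp]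
  fin_cases a <;> fin_cases b <;>
    simp [hs, cylinderParam, cylinderMap, prodCoord, sq]

theorem IsRegularCurve.inducedMetric_arcLengthCoord (hI : IsOpen I) (hI' : I.OrdConnected)
    (hγ : IsRegularCurve γ I) {u₀ : ℝ} (hu₀ : u₀ ∈ I) {p : Fin 2 → ℝ} (hp : p ∈ strip I) :
    inducedMetric euclMetric (arcLengthCoord γ u₀) p =
      Matrix.diagonal ![hypSpeed γ (p 0) ^ 2, 1] := by
  ext a b
  simp only [inducedMetric, Matrix.of_apply, euclMetric, innerG_one,
    hγ.partialD_arcLengthCoord hI hI' hu₀ hp]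
  fin_cases a <;> fin_cases b <;> simp [sq]

/-! ### Intrinsic curvature -/

theorem IsRegularCurve.christoffel_inducedMetric (hI : IsOpen I) (hγ : IsRegularCurve γ I)
    {p : Fin 2 → ℝ} (hp : p ∈ strip I) (k j : Fin 2) :
    christoffel (inducedMetric prodMetric (cylinderParam γ)) k 1 j p = 0 ∧
      christoffel (inducedMetric prodMetric (cylinderParam γ)) k j 1 p = 0 := by
  -- The diagonal form is known only on the strip; since the strip is open, this suffices for
  -- derivatives at `p`.
  have key (i j : Fin 2) : Set.EqOn (fun z => inducedMetric prodMetric (cylinderParam γ) z i j)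
      (fun z => Matrix.diagonal ![hypSpeed γ (z 0) ^ 2, 1] i j) (strip I) :=
    fun z hz => by simp only [hγ.inducedMetric_cylinderParam hI hz]
  have hU := isOpen_strip hI
  refine christoffel_eq_zero_of_row (fun i l => ?_) (fun i l => ?_) (fun i j => ?_) k j
  all_goals rw [partialD_congr hU (key _ _) _ hp]
  · fin_cases l <;> simp [partialD_const]
  · fin_cases l <;> simp [partialD_const]
  · exact partialD_eq_zero_of_invariant fun t => by simp

/-- Every term of `R(∂₀, ∂₁)∂₁` contains a Christoffel symbol with last lower index `1`, or a
derivative of one, so the numerator of the curvature already vanishes. -/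
theorem IsRegularCurve.gaussianCurvature_eq_zero (hI : IsOpen I) (hγ : IsRegularCurve γ I)
    {p : Fin 2 → ℝ} (hp : p ∈ strip I) :
    gaussianCurvature (inducedMetric prodMetric (cylinderParam γ)) p = 0 := by
  have hU := isOpen_strip hI
  have hz (k j : Fin 2) {q : Fin 2 → ℝ} (hq : q ∈ strip I) :=
    hγ.christoffel_inducedMetric hI hq k j
  have hl (a l j : Fin 2) :
      partialD a (christoffel (inducedMetric prodMetric (cylinderParam γ)) l j 1) p = 0 := by
    rw [partialD_congr hU (g := fun _ => 0) (fun q hq => (hz l j hq).2) a hp, partialD_const]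
  have hr (l : Fin 2) : riemann (inducedMetric prodMetric (cylinderParam γ)) l 1 0 1 p = 0 := by
    simp [riemann, hl, (hz _ _ hp).2]
  simp [gaussianCurvature, hr]

/-! ### Extrinsic curvature -/

theorem IsRegularCurve.exists_isUnitNormal (hI : IsOpen I) (hγ : IsRegularCurve γ I)
    {p : Fin 2 → ℝ} (hp : p ∈ strip I) :
    ∃ n, IsUnitNormal prodMetric (cylinderParam γ) p n := by
  have hs := hγ.hypSpeed_sq hp
  have hpos := hγ.hypSpeed_pos hp
  have him := (γ (p 0)).im_pos
  simp only [IsUnitNormal, hγ.partialD_cylinderParam hI hp, innerG_prodMetric]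
  generalize hypSpeed γ (p 0) = s at *
  generalize deriv (fun v => hypCoord (γ v)) (p 0) = c at *
  -- The velocity turned by a right angle; conformality of the hyperbolic metric keeps its length
  -- `s`, hence the division.
  refine ⟨![-c 1 / s, c 0 / s, 0], ?_, fun a => ?_⟩
  · simp only [cylinderParam, cylinderMap, prodCoord, Matrix.cons_val]
    field_simp at hs ⊢
    linarith
  · fin_cases a
    · simp
      left; ring
    · simp

/-- The first derivative vanishes since `∂₁X` is the constant vertical vector, the second since
`∂ₐX` does not depend on `t`; the connection terms carry a lower index `2` in both cases. -/
theorem IsRegularCurve.covDerivAlong_eq_zero (hI : IsOpen I) (hγ : IsRegularCurve γ I)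
    {p : Fin 2 → ℝ} (hp : p ∈ strip I) (a : Fin 2) :
    covDerivAlong prodMetric (cylinderParam γ) a (partialD 1 (cylinderParam γ)) p = 0 ∧
      covDerivAlong prodMetric (cylinderParam γ) 1 (partialD a (cylinderParam γ)) p = 0 := by
  have hU := isOpen_strip hI
  have h1 : partialD a (partialD 1 (cylinderParam γ)) p = 0 := by
    rw [partialD_congr hU (fun q hq => hγ.partialD_cylinderParam hI hq 1) a hp]
    exact partialD_const _ a p
  have h2 : partialD 1 (partialD a (cylinderParam γ)) p = 0 := by
    rw [partialD_congr hU (fun q hq => hγ.partialD_cylinderParam hI hq a) 1 hp]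
    exact partialD_eq_zero_of_invariant fun t => by simp
  constructor
  · funext k
    simp [covDerivAlong, h1, hγ.partialD_cylinderParam hI hp 1, Fin.sum_univ_three,
      (prodMetric_christoffel _ _ _).2]
  · funext k
    simp [covDerivAlong, h2, hγ.partialD_cylinderParam hI hp 1, Fin.sum_univ_three,
      (prodMetric_christoffel _ _ _).1]

theorem IsRegularCurve.shapeOperator_eq (hI : IsOpen I) (hγ : IsRegularCurve γ I)
    {p : Fin 2 → ℝ} (hp : p ∈ strip I) (n : Fin 3 → ℝ) :
    ∃ κ : ℝ, shapeOperator prodMetric (cylinderParam γ) p n = Matrix.diagonal ![κ, 0] := by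
  have hII : secondFundamentalForm prodMetric (cylinderParam γ) p n =
      Matrix.diagonal ![secondFundamentalForm prodMetric (cylinderParam γ) p n 0 0, 0] := by
    ext a b
    fin_cases a <;> fin_cases b <;>
      simp [secondFundamentalForm, (hγ.covDerivAlong_eq_zero hI hp _).1,
        (hγ.covDerivAlong_eq_zero hI hp _).2, innerG]
  rw [shapeOperator, hII, hγ.inducedMetric_cylinderParam hI hp, Matrix.inv_diagonal,
    Matrix.diagonal_mul_diagonal]
  -- The inverse need not be evaluated: the other diagonal entry is a multiple of `0` anyway.
  refine ⟨Ring.inverse ![hypSpeed γ (p 0) ^ 2, (1 : ℝ)] 0 *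
    secondFundamentalForm prodMetric (cylinderParam γ) p n 0 0,
    congrArg Matrix.diagonal (funext fun i => ?_)⟩
  fin_cases i
  · rfl
  · simp

/-- The characteristic polynomial splits as `(X - κ)(X - 0)`; roots are counted with multiplicity,
so `κ = 0` is no exception. -/
theorem IsRegularCurve.principalCurvatures_eq (hI : IsOpen I) (hγ : IsRegularCurve γ I)
    {p : Fin 2 → ℝ} (hp : p ∈ strip I) (n : Fin 3 → ℝ) :
    ∃ κ : ℝ, principalCurvatures prodMetric (cylinderParam γ) p n = {κ, 0} := by
  obtain ⟨κ, hκ⟩ := hγ.shapeOperator_eq hI hp n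
  refine ⟨κ, ?_⟩
  rw [principalCurvatures, hκ, Matrix.charpoly_diagonal, Fin.prod_univ_two,
    Polynomial.roots_mul (mul_ne_zero (Polynomial.X_sub_C_ne_zero _)
      (Polynomial.X_sub_C_ne_zero _)), Polynomial.roots_X_sub_C, Polynomial.roots_X_sub_C]
  rfl

end RegularCurve

theorem cylinderMap_image_strip (γ : ℝ → UpperHalfPlane) (I : Set ℝ) :
    cylinderMap γ '' strip I = cylinder γ I := by
  ext ⟨z, t⟩
  constructor
  · rintro ⟨p, hp, h⟩
    obtain ⟨rfl, rfl⟩ := Prod.mk.inj h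
    exact ⟨⟨p 0, hp, rfl⟩, trivial⟩
  · rintro ⟨⟨u, hu, rfl⟩, -⟩
    exact ⟨![u, t], hu, rfl⟩

end CylinderTheorem

theorem proposition1 (I : Set ℝ) (hI : IsOpen I) (hI' : I.OrdConnected)
    (γ : ℝ → UpperHalfPlane) (hγ : CylinderTheorem.IsRegularCurve γ I) :
    -- `(u, t) ↦ (γ(u), t)` is an immersion of `I × ℝ` onto the cylinder `γ × ℝ`
    (CylinderTheorem.cylinderMap γ '' CylinderTheorem.strip I = CylinderTheorem.cylinder γ I ∧
      CylinderTheorem.IsImmersionOn (CylinderTheorem.cylinderParam γ)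
        (CylinderTheorem.strip I)) ∧
    -- the induced metric is `ds² + dt²`, where `s` is the arc length of `γ`
    (∀ u₀ ∈ I,
      ContDiffOn ℝ ∞ (CylinderTheorem.arcLength γ u₀) I ∧
      StrictMonoOn (CylinderTheorem.arcLength γ u₀) I ∧
      ∀ p ∈ CylinderTheorem.strip I,
        CylinderTheorem.inducedMetric CylinderTheorem.prodMetric
            (CylinderTheorem.cylinderParam γ) p =
          CylinderTheorem.inducedMetric CylinderTheorem.euclMetric
            (CylinderTheorem.arcLengthCoord γ u₀) p) ∧
    -- the Gaussian curvature of the induced metric vanishes identically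
    (∀ p ∈ CylinderTheorem.strip I,
      CylinderTheorem.gaussianCurvature
        (CylinderTheorem.inducedMetric CylinderTheorem.prodMetric
          (CylinderTheorem.cylinderParam γ)) p = 0) ∧
    -- at every point, and for either unit normal, there are two principal curvatures, one of them
    -- is zero, and the extrinsic curvature vanishes
    (∀ p ∈ CylinderTheorem.strip I,
      (∃ n, CylinderTheorem.IsUnitNormal CylinderTheorem.prodMetric
        (CylinderTheorem.cylinderParam γ) p n) ∧
      ∀ n, CylinderTheorem.IsUnitNormal CylinderTheorem.prodMetric
          (CylinderTheorem.cylinderParam γ) p n →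
        Multiset.card (CylinderTheorem.principalCurvatures CylinderTheorem.prodMetric
          (CylinderTheorem.cylinderParam γ) p n) = 2 ∧
        0 ∈ CylinderTheorem.principalCurvatures CylinderTheorem.prodMetric
          (CylinderTheorem.cylinderParam γ) p n ∧
        CylinderTheorem.extrinsicCurvature CylinderTheorem.prodMetric
          (CylinderTheorem.cylinderParam γ) p n = 0) := by
  refine ⟨⟨CylinderTheorem.cylinderMap_image_strip γ I, hγ.isImmersionOn_cylinderParam hI⟩,
    fun u₀ hu₀ => ⟨hγ.contDiffOn_arcLength hI hI' hu₀, hγ.strictMonoOn_arcLength hI hI' hu₀,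
      fun p hp => ?_⟩,
    fun p hp => hγ.gaussianCurvature_eq_zero hI hp,
    fun p hp => ⟨hγ.exists_isUnitNormal hI hp, fun n _ => ?_⟩⟩
  · rw [hγ.inducedMetric_cylinderParam hI hp, hγ.inducedMetric_arcLengthCoord hI hI' hu₀ hp]
  · obtain ⟨κ, hκ⟩ := hγ.principalCurvatures_eq hI hp n
    simp [CylinderTheorem.extrinsicCurvature, hκ]
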